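/- Let $n \ge 4$, let $S_n$ be the symmetric group on $[n]=\{1,\dots,n\}$, and let $D_n \subseteq S_n$ be the set of derangements, i.e. the permutations without fixed points. Let $\Gamma_n$ be the derangement graph, that is, the Cayley graph of $S_n$ with connection set $D_n$: its vertices are the $n!$ permutations in $S_n$, and $g,h\in S_n$ are adjacent if and only if $h = sg$ for some $s \in D_n$, equivalently if and only if $g(i)\neq h(i)$ for all $i\in[n]$. Then $\Gamma_n$ is edge pancyclic: for every edge $e$ of $\Gamma_n$ and every integer $\ell$ with $3\le \ell\le n!$, there is a cycle of length $\ell$ in $\Gamma_n$ that contains $e$. -/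

import Mathlib

/-- A finite simple graph is edge pancyclic if every edge lies on a cycle of each length
from `3` to the number of vertices. -/
def SimpleGraph.IsEdgePancyclic {V : Type*} [Fintype V] (G : SimpleGraph V) : Prop :=
  ∀ e ∈ G.edgeSet, ∀ l : ℕ, 3 ≤ l → l ≤ Fintype.card V →
    ∃ (u : V) (p : G.Walk u u), p.IsCycle ∧ p.length = l ∧ e ∈ p.edges

/-- The derangement graph: the Cayley graph of the symmetric group on `n` points whose
connection set is the set of all derangements. Since this set is closed under inverses and
conjugation, left and right multiplication give the same graph
(see `derangementGraph_adj_iff_exists`). -/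
def derangementGraph (n : ℕ) : SimpleGraph (Equiv.Perm (Fin n)) :=
  SimpleGraph.mulCayley (derangements (Fin n))

/-- For `n ≥ 1`, two permutations are adjacent iff they differ in every position. -/
theorem derangementGraph_adj_iff {n : ℕ} (hn : 1 ≤ n) (g h : Equiv.Perm (Fin n)) :
    (derangementGraph n).Adj g h ↔ ∀ i, g i ≠ h i := by
  unfold derangementGraph
  rw [SimpleGraph.mulCayley_adj']
  constructor
  · rintro ⟨-, s, hs, rfl | rfl⟩ i hi
    · exact hs i (g.injective hi).symm
    · exact hs i (h.injective hi)
  · intro hd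
    refine ⟨fun e => hd ⟨0, hn⟩ (by rw [e]), g⁻¹ * h, fun i hi => hd i ?_, Or.inl (by simp)⟩
    rw [Equiv.Perm.mul_apply, Equiv.Perm.inv_eq_iff_eq] at hi
    exact hi.symm

/-- For `n ≥ 1`, `u` and `v` are adjacent iff `v = s * u` for some derangement `s`. -/
theorem derangementGraph_adj_iff_exists {n : ℕ} (hn : 1 ≤ n) (u v : Equiv.Perm (Fin n)) :
    (derangementGraph n).Adj u v ↔ ∃ s ∈ derangements (Fin n), v = s * u := by
  rw [derangementGraph_adj_iff hn]
  constructor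
  · intro hd
    refine ⟨v * u⁻¹, fun i hi => hd (u⁻¹ i) ?_, by simp⟩
    rw [Equiv.Perm.mul_apply] at hi
    exact (u.apply_symm_apply i).trans hi.symm
  · rintro ⟨s, hs, rfl⟩ i hi
    exact hs (u i) hi.symm

open Equiv

/-! Maximum cliques are Latin squares, read as sets of rows. By Hall's theorem the two ends of the
given edge extend to such a clique `Q`. For `k` in the stabilizer of `0` the right translates `Q *
k` are cliques that partition the group, and the stabilizer can be listed so that consecutive
elements differ by a transposition. It suffices to find paths between the ends with any number `l ≥
3` of vertices. If one clique is not enough, two consecutive vertices on the path through it are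
separated by a detour into the next clique, and recursion supplies the detour. This needs two
disjoint edges between `Q` and `Q * swap a b` (`exists_disjoint_edges`), which exist once `n ≥ 4`.
-/

/-! ### Listing the symmetric group by transpositions. -/

/-- Two permutations differ by a transposition. -/
def DifferBySwap {α : Type*} [DecidableEq α] (g h : Perm α) : Prop :=
  ∃ a b, a ≠ b ∧ h = swap a b * g

/-- `decomposeFin.symm (p, g)` is `swap 0 p` after `g` shifted to fix `0`, so the transposition gets
conjugated by `swap 0 p`. -/
theorem DifferBySwap.decomposeFin_symm {n : ℕ} (p : Fin (n + 1)) {g h : Perm (Fin n)}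
    (H : DifferBySwap g h) :
    DifferBySwap (Perm.decomposeFin.symm (p, g)) (Perm.decomposeFin.symm (p, h)) := by
  obtain ⟨a, b, hab, rfl⟩ := H
  refine ⟨swap 0 p a.succ, swap 0 p b.succ, fun e => hab ?_, ?_⟩
  · exact Fin.succ_injective _ ((swap 0 p).injective e)
  · refine Equiv.ext fun i => ?_
    refine Fin.cases ?_ (fun i => ?_) i
    · have h1 : swap 0 p a.succ ≠ p := fun e => by
        have : swap 0 p a.succ = swap 0 p 0 := by rw [e, swap_apply_left]
        exact Fin.succ_ne_zero _ ((swap 0 p).injective this)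
      have h2 : swap 0 p b.succ ≠ p := fun e => by
        have : swap 0 p b.succ = swap 0 p 0 := by rw [e, swap_apply_left]
        exact Fin.succ_ne_zero _ ((swap 0 p).injective this)
      rw [Perm.mul_apply, Perm.decomposeFin_symm_apply_zero, Perm.decomposeFin_symm_apply_zero,
        swap_apply_of_ne_of_ne h1.symm h2.symm]
    · rw [Perm.mul_apply, Perm.decomposeFin_symm_apply_succ, Perm.decomposeFin_symm_apply_succ,
        (swap 0 p).injective.swap_apply, Perm.mul_apply, (Fin.succ_injective n).swap_apply]

/-- The permutations of `Fin n` can be listed, starting with any given one, such that consecutive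
ones differ by a transposition. -/
theorem exists_swap_hamiltonian_list (n : ℕ) (g : Perm (Fin n)) :
    ∃ L : List (Perm (Fin n)), L.head? = some g ∧ L.IsChain DifferBySwap ∧ L.Nodup ∧
      ∀ σ, σ ∈ L := by
  induction n with
  | zero => exact ⟨[g], by simp, by simp, by simp, fun σ => by simp [Subsingleton.elim σ g]⟩
  | succ n ih =>
    have coset (p : Fin (n + 1)) (σ : Perm (Fin n)) : ∃ L : List (Perm (Fin (n + 1))),
        L.head? = some (Perm.decomposeFin.symm (p, σ)) ∧ L.IsChain DifferBySwap ∧ L.Nodup ∧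
          ∀ τ, τ ∈ L ↔ τ 0 = p := by
      obtain ⟨L, h1, h2, h3, h4⟩ := ih σ
      refine ⟨L.map fun τ => Perm.decomposeFin.symm (p, τ), by simp [h1],
        List.isChain_map_of_isChain _ (fun _ _ h => h.decomposeFin_symm p) h2,
        h3.map fun a b h => by simpa using h, fun τ => ?_⟩
      obtain ⟨⟨q, τ⟩, rfl⟩ := Perm.decomposeFin.symm.surjective τ
      simp [h4, eq_comm]
    have cosets (J : List (Fin (n + 1))) : ∀ (p : Fin (n + 1)) (σ : Perm (Fin n)),
        (p :: J).Nodup → ∃ L : List (Perm (Fin (n + 1))),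
        L.head? = some (Perm.decomposeFin.symm (p, σ)) ∧ L.IsChain DifferBySwap ∧ L.Nodup ∧
          ∀ τ, τ ∈ L ↔ τ 0 ∈ p :: J := by
      induction J with
      | nil => exact fun p σ _ => by simpa using coset p σ
      | cons q J ihJ =>
        intro p σ hJ
        obtain ⟨L, h1, h2, h3, h4⟩ := coset p σ
        have hL : L ≠ [] := by rintro rfl; simp at h1
        have hlast : L.getLast hL 0 = p := (h4 _).1 (List.getLast_mem hL)
        have hpq : p ≠ q := by rintro rfl; simp at hJ
        -- Left multiplication by `swap p q` moves the value at `0` from `p` to `q`. The next coset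
        -- is entered wherever this lands, hence the arbitrary starting point in the induction.
        obtain ⟨⟨r, σ'⟩, hr⟩ := Perm.decomposeFin.symm.surjective (swap p q * L.getLast hL)
        obtain rfl : r = q := by
          have := congrArg (fun τ : Perm (Fin (n + 1)) => τ 0) hr
          simpa [hlast] using this
        obtain ⟨M, k1, k2, k3, k4⟩ := ihJ r σ' (List.nodup_cons.1 hJ).2
        refine ⟨L ++ M, by simp [List.head?_append, h1], ?_, ?_, fun τ => ?_⟩
        · refine List.isChain_append.2 ⟨h2, k2, fun x hx y hy => ?_⟩
          rw [k1, hr] at hy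
          rw [List.getLast?_eq_some_getLast hL] at hx
          obtain rfl := Option.mem_some_iff.1 hx
          obtain rfl := Option.mem_some_iff.1 hy
          exact ⟨p, r, hpq, rfl⟩
        · refine List.Nodup.append h3 k3 fun τ ht ht' => ?_
          rw [h4] at ht
          rw [k4, ht] at ht'
          exact (List.nodup_cons.1 hJ).1 ht'
        · rw [List.mem_append, h4, k4, List.mem_cons (b := p)]
    obtain ⟨⟨p, σ⟩, rfl⟩ := Perm.decomposeFin.symm.surjective g
    obtain ⟨L, h1, h2, h3, h4⟩ := cosets ((List.finRange (n + 1)).erase p) p σ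
      (List.nodup_cons.2 ⟨(List.nodup_finRange _).not_mem_erase,
        (List.nodup_finRange _).erase p⟩)
    refine ⟨L, h1, h2, h3, fun τ => (h4 τ).2 ?_⟩
    by_cases h : τ 0 = p
    · simp [h]
    · exact List.mem_cons_of_mem _ ((List.mem_erase_of_ne h).2 (List.mem_finRange _))

/-! ### Latin squares as maximum cliques. -/

section Clique

variable {n : ℕ}

theorem derangementGraph_adj_mul_right (hn : 1 ≤ n) {g h : Perm (Fin n)}
    (H : (derangementGraph n).Adj g h) (k : Perm (Fin n)) :
    (derangementGraph n).Adj (g * k) (h * k) := by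
  rw [derangementGraph_adj_iff hn] at H ⊢
  exact fun i => H (k i)

theorem eq_of_apply_eq_of_isClique (hn : 1 ≤ n) {Q : Finset (Perm (Fin n))}
    (hQ : (derangementGraph n).IsClique (Q : Set (Perm (Fin n)))) {q r : Perm (Fin n)}
    (hq : q ∈ Q) (hr : r ∈ Q) {i : Fin n} (h : q i = r i) : q = r := by
  by_contra hne
  exact (derangementGraph_adj_iff hn q r).1 (hQ hq hr hne) i h

/-- A Latin rectangle with fewer than `n` rows can be extended by one row. -/
theorem exists_adj_of_isClique (hn : 1 ≤ n) {S : Finset (Perm (Fin n))}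
    (hS : (derangementGraph n).IsClique (S : Set (Perm (Fin n)))) (hcard : S.card < n) :
    ∃ r, ∀ s ∈ S, (derangementGraph n).Adj s r := by
  classical
  let t : Fin n → Finset (Fin n) := fun i => (S.image fun s => s i)ᶜ
  have hall : ∀ A : Finset (Fin n), A.card ≤ (A.biUnion t).card := by
    intro A
    -- Double counting for Hall's condition: a column misses at least `n - S.card` values, and a
    -- value is missing from at most that many columns, since the rows place it in distinct columns.
    have key : A.card * (n - S.card) ≤ (A.biUnion t).card * (n - S.card) := by
      refine Finset.card_mul_le_card_mul (fun i v => v ∈ t i) (fun i hi => ?_) fun v _ => ?_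
      · have h1 : t i ⊆ (A.biUnion t).bipartiteAbove (fun i v => v ∈ t i) i := fun v hv =>
          Finset.mem_filter.2 ⟨Finset.mem_biUnion.2 ⟨i, hi, hv⟩, hv⟩
        refine le_trans ?_ (Finset.card_le_card h1)
        have h2 : (S.image fun s => s i).card ≤ S.card := Finset.card_image_le
        simp only [t, Finset.card_compl, Fintype.card_fin]
        omega
      · have h1 : A.bipartiteBelow (fun i v => v ∈ t i) v ⊆ (S.image fun s => s.symm v)ᶜ := by
          intro i hi
          have hi' : v ∈ t i := (Finset.mem_filter.1 hi).2
          simp only [t, Finset.mem_compl, Finset.mem_image, not_exists, not_and] at hi' ⊢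
          intro s hs e
          exact hi' s hs (by rw [← e, apply_symm_apply])
        have h2 : (S.image fun s => s.symm v).card = S.card := by
          refine Finset.card_image_of_injOn fun s hs r hr e => ?_
          refine eq_of_apply_eq_of_isClique hn hS hs hr (i := s.symm v) ?_
          have e' : s.symm v = r.symm v := e
          rw [apply_symm_apply, e', apply_symm_apply]
        refine (Finset.card_le_card h1).trans ?_
        rw [Finset.card_compl, Fintype.card_fin, h2]
    exact Nat.le_of_mul_le_mul_right key (by omega)
  obtain ⟨f, hf, hft⟩ := (Finset.all_card_le_biUnion_card_iff_exists_injective t).1 hall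
  refine ⟨Equiv.ofBijective f (Finite.injective_iff_bijective.1 hf), fun s hs => ?_⟩
  rw [derangementGraph_adj_iff hn]
  intro i hi
  have := hft i
  simp only [t, Finset.mem_compl, Finset.mem_image, not_exists, not_and] at this
  exact this s hs hi

/-- A Latin rectangle can be completed to a Latin square. -/
theorem exists_isClique_card_eq (hn : 1 ≤ n) (k : ℕ) : ∀ S : Finset (Perm (Fin n)),
    (derangementGraph n).IsClique (S : Set (Perm (Fin n))) → S.card + k = n →
    ∃ Q, S ⊆ Q ∧ (derangementGraph n).IsClique (Q : Set (Perm (Fin n))) ∧ Q.card = n := by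
  classical
  induction k with
  | zero => exact fun S hS h => ⟨S, subset_rfl, hS, h⟩
  | succ k ih =>
    intro S hS h
    obtain ⟨r, hr⟩ := exists_adj_of_isClique hn hS (by omega)
    have hrS : r ∉ S := fun h => (hr r h).ne rfl
    obtain ⟨Q, h1, h2⟩ := ih (insert r S)
      (by rw [Finset.coe_insert]; exact hS.insert fun s hs _ => (hr s hs).symm)
      (by rw [Finset.card_insert_of_notMem hrS]; omega)
    exact ⟨Q, (Finset.subset_insert _ _).trans h1, h2⟩

theorem exists_mem_apply_eq (hn : 1 ≤ n) {Q : Finset (Perm (Fin n))}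
    (hQ : (derangementGraph n).IsClique (Q : Set (Perm (Fin n)))) (hcard : Q.card = n)
    (i v : Fin n) : ∃ q ∈ Q, q i = v := by
  classical
  have h : Q.image (fun q => q i) = Finset.univ := by
    refine Finset.eq_univ_of_card _ ?_
    rw [Finset.card_image_of_injOn, hcard, Fintype.card_fin]
    exact fun q hq r hr e => eq_of_apply_eq_of_isClique hn hQ hq hr e
  simpa using Finset.eq_univ_iff_forall.1 h v

/-- Distinct rows agree nowhere, so only the columns `a` and `b` need checking; a third column rules
out `q = r`. -/
theorem adj_mul_swap_iff (hn : 3 ≤ n) {Q : Finset (Perm (Fin n))}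
    (hQ : (derangementGraph n).IsClique (Q : Set (Perm (Fin n)))) {q r : Perm (Fin n)}
    (hq : q ∈ Q) (hr : r ∈ Q) (a b : Fin n) :
    (derangementGraph n).Adj q (r * swap a b) ↔ q ≠ r ∧ q a ≠ r b ∧ q b ≠ r a := by
  rw [derangementGraph_adj_iff (by omega)]
  constructor
  · intro h
    refine ⟨?_, by simpa using h a, by simpa using h b⟩
    rintro rfl
    obtain ⟨c, -, hc⟩ := Finset.exists_mem_notMem_of_card_lt_card
      (s := {a, b}) (t := (Finset.univ : Finset (Fin n)))
      (by rw [Finset.card_univ, Fintype.card_fin]; exact lt_of_le_of_lt Finset.card_le_two hn)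
    simp only [Finset.mem_insert, Finset.mem_singleton, not_or] at hc
    exact h c (by rw [Perm.mul_apply, swap_apply_of_ne_of_ne hc.1 hc.2])
  · rintro ⟨h1, h2, h3⟩ i
    rw [Perm.mul_apply]
    rcases eq_or_ne i a with rfl | ha
    · rwa [swap_apply_left]
    rcases eq_or_ne i b with rfl | hb
    · rwa [swap_apply_right]
    rw [swap_apply_of_ne_of_ne ha hb]
    exact fun e => h1 (eq_of_apply_eq_of_isClique (by omega) hQ hq hr e)

/-- At most three rows are excluded: `q`, the row with `q a` in column `b`, and the row with `q b`
in column `a`. -/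
theorem exists_adj_mul_swap (hn : 4 ≤ n) {Q : Finset (Perm (Fin n))}
    (hQ : (derangementGraph n).IsClique (Q : Set (Perm (Fin n)))) (hcard : Q.card = n)
    (a b : Fin n) {q : Perm (Fin n)} (hq : q ∈ Q) :
    ∃ r ∈ Q, (derangementGraph n).Adj q (r * swap a b) := by
  classical
  obtain ⟨s, hs, hsb⟩ := exists_mem_apply_eq (by omega) hQ hcard b (q a)
  obtain ⟨t, ht, hta⟩ := exists_mem_apply_eq (by omega) hQ hcard a (q b)
  obtain ⟨r, hr, hne⟩ := Finset.exists_mem_notMem_of_card_lt_card (s := {q, s, t}) (t := Q)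
    (lt_of_le_of_lt Finset.card_le_three (by omega))
  simp only [Finset.mem_insert, Finset.mem_singleton, not_or] at hne
  refine ⟨r, hr, (adj_mul_swap_iff (by omega) hQ hq hr a b).2 ⟨Ne.symm hne.1, ?_, ?_⟩⟩
  · exact fun e => hne.2.1 (eq_of_apply_eq_of_isClique (by omega) hQ hr hs (e.symm.trans hsb.symm))
  · exact fun e => hne.2.2 (eq_of_apply_eq_of_isClique (by omega) hQ hr ht (e.symm.trans hta.symm))

/-- Between a maximum clique and its translate by a transposition there are two disjoint edges,
one at a prescribed vertex `m` and the other one avoiding a prescribed vertex `d`. -/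
theorem exists_disjoint_edges (hn : 4 ≤ n) {Q : Finset (Perm (Fin n))}
    (hQ : (derangementGraph n).IsClique (Q : Set (Perm (Fin n)))) (hcard : Q.card = n)
    {a b : Fin n} (hab : a ≠ b) {m : Perm (Fin n)} (hm : m ∈ Q) (d : Perm (Fin n)) :
    ∃ v ∈ Q, v ≠ m ∧ v ≠ d ∧ ∃ m' ∈ Q, ∃ v' ∈ Q, m' ≠ v' ∧
      (derangementGraph n).Adj m (m' * swap a b) ∧
      (derangementGraph n).Adj v (v' * swap a b) := by
  obtain ⟨z, hz, hmz⟩ := exists_adj_mul_swap hn hQ hcard a b hm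
  have hmz' := (adj_mul_swap_iff (by omega) hQ hm hz a b).1 hmz
  -- Any non-neighbour `v ≠ d` of `z * swap a b` suffices: it differs from `m`, and its own
  -- neighbour differs from that of `m`. Take `v = z`, or a row clashing with `z` across `a` and `b`
  -- when `z = d`.
  have finish : ∀ v ∈ Q, v ≠ d → ¬ (derangementGraph n).Adj v (z * swap a b) →
      ∃ v ∈ Q, v ≠ m ∧ v ≠ d ∧ ∃ m' ∈ Q, ∃ v' ∈ Q, m' ≠ v' ∧
      (derangementGraph n).Adj m (m' * swap a b) ∧
      (derangementGraph n).Adj v (v' * swap a b) := by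
    intro v hv hvd hvz
    obtain ⟨v', hv', hvv'⟩ := exists_adj_mul_swap hn hQ hcard a b hv
    refine ⟨v, hv, ?_, hvd, z, hz, v', hv', ?_, hmz, hvv'⟩
    · rintro rfl; exact hvz hmz
    · rintro rfl; exact hvz hvv'
  by_cases hzd : z = d
  · obtain ⟨w, hw, hwa⟩ := exists_mem_apply_eq (by omega) hQ hcard a (z b)
    refine finish w hw ?_ fun h => ((adj_mul_swap_iff (by omega) hQ hw hz a b).1 h).2.1 hwa
    rintro rfl
    subst hzd
    exact hab (z.injective hwa)
  · exact finish z hz hzd fun h => ((adj_mul_swap_iff (by omega) hQ hz hz a b).1 h).1 rfl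

end Clique

/-! ### Lists with prescribed ends, and splicing. -/

/-- A finite set with distinct elements `x`, `y`, `m` and a further element `v ≠ m` can be
listed from `x` to `y` with `m` and `v` next to each other. -/
theorem Finset.exists_list_with_consecutive {α : Type*} [DecidableEq α] (B : Finset α)
    {x y m v : α} (hx : x ∈ B) (hy : y ∈ B) (hm : m ∈ B) (hv : v ∈ B) (hxy : x ≠ y)
    (hmx : m ≠ x) (hmy : m ≠ y) (hvm : v ≠ m) :
    ∃ (A C : List α) (u w : α), (u = m ∧ w = v ∨ u = v ∧ w = m) ∧
      (A ++ u :: w :: C).Nodup ∧ (A ++ u :: w :: C).head? = some x ∧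
      (A ++ u :: w :: C).getLast? = some y ∧ (A ++ u :: w :: C).length = B.card ∧
      ∀ z ∈ A ++ u :: w :: C, z ∈ B := by
  have len : ∀ L : List α, L.Nodup → (∀ z, z ∈ L ↔ z ∈ B) → L.length = B.card := by
    intro L h1 h2
    rw [← List.toFinset_card_of_nodup h1]
    congr 1
    ext z
    simp [h2]
  rcases eq_or_ne v x with rfl | hvx
  · let R := (((B.erase v).erase y).erase m).toList
    have hR : ∀ z, z ∈ R ↔ z ≠ m ∧ z ≠ y ∧ z ≠ v ∧ z ∈ B := fun z => by simp [R]
    have hRn : R.Nodup := Finset.nodup_toList _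
    have h1 : (v :: m :: (R ++ [y])).Nodup := by
      simp [List.nodup_append, hRn, hR]; grind
    have h2 : ∀ z, z ∈ (v :: m :: (R ++ [y])) ↔ z ∈ B := by
      intro z; simp [hR]; grind
    exact ⟨[], R ++ [y], v, m, .inr ⟨rfl, rfl⟩, h1, rfl, by simp [List.getLast?_cons],
      len _ h1 h2, fun z hz => (h2 z).1 hz⟩
  rcases eq_or_ne v y with rfl | hvy
  · let R := (((B.erase x).erase v).erase m).toList
    have hR : ∀ z, z ∈ R ↔ z ≠ m ∧ z ≠ v ∧ z ≠ x ∧ z ∈ B := fun z => by simp [R]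
    have hRn : R.Nodup := Finset.nodup_toList _
    have h1 : ((x :: R) ++ m :: v :: []).Nodup := by
      simp [List.nodup_append, hRn, hR]; grind
    have h2 : ∀ z, z ∈ ((x :: R) ++ m :: v :: []) ↔ z ∈ B := by
      intro z; simp [hR]; grind
    exact ⟨x :: R, [], m, v, .inl ⟨rfl, rfl⟩, h1, rfl, by simp [List.getLast?_cons],
      len _ h1 h2, fun z hz => (h2 z).1 hz⟩
  · let R := ((((B.erase x).erase y).erase m).erase v).toList
    have hR : ∀ z, z ∈ R ↔ z ≠ v ∧ z ≠ m ∧ z ≠ y ∧ z ≠ x ∧ z ∈ B := fun z => by simp [R]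
    have hRn : R.Nodup := Finset.nodup_toList _
    have h1 : ([x] ++ m :: v :: (R ++ [y])).Nodup := by
      simp [List.nodup_append, hRn, hR]; grind
    have h2 : ∀ z, z ∈ ([x] ++ m :: v :: (R ++ [y])) ↔ z ∈ B := by
      intro z; simp [hR]; grind
    exact ⟨[x], R ++ [y], m, v, .inl ⟨rfl, rfl⟩, h1, rfl, by simp [List.getLast?_cons],
      len _ h1 h2, fun z hz => (h2 z).1 hz⟩

/-- Splicing a chain between two consecutive entries of another one. -/
theorem List.IsChain.splice {α : Type*} {R : α → α → Prop} {A C P : List α} {u w u' w' : α}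
    (h : (A ++ u :: w :: C).IsChain R) (hP : P.IsChain R) (hu : P.head? = some u')
    (hw : P.getLast? = some w') (huu : R u u') (hww : R w' w) :
    (A ++ u :: (P ++ w :: C)).IsChain R := by
  rw [List.isChain_append_cons_cons] at h
  obtain ⟨h1, -, h3⟩ := h
  have : A ++ u :: (P ++ w :: C) = (A ++ [u]) ++ (P ++ w :: C) := by simp
  rw [this]
  refine List.isChain_append.2 ⟨h1, List.isChain_append.2 ⟨hP, h3, ?_⟩, ?_⟩
  · simpa [hw] using hww
  · simpa [List.head?_append, hu] using huu

theorem List.perm_splice {α : Type*} (A C P : List α) (u w : α) :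
    (A ++ u :: (P ++ w :: C)).Perm (P ++ (A ++ u :: w :: C)) := by
  have h : ((A ++ [u]) ++ P ++ w :: C).Perm (P ++ (A ++ [u]) ++ w :: C) :=
    List.perm_append_comm.append_right _
  simpa using h

/-! ### Paths through successive cliques. -/

/-- The recursion over the cliques `Q * h`: any number of vertices can be visited on the way between
two vertices of the first clique. -/
theorem exists_path_list {n : ℕ} (hn : 4 ≤ n) {Q : Finset (Perm (Fin n))}
    (hQ : (derangementGraph n).IsClique (Q : Set (Perm (Fin n)))) (hcard : Q.card = n)
    (hs : List (Perm (Fin n))) : ∀ (h : Perm (Fin n)), (h :: hs).IsChain DifferBySwap →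
    (h :: hs).Pairwise (fun k k' => ∀ q ∈ Q, ∀ q' ∈ Q, q * k ≠ q' * k') →
    ∀ x ∈ Q, ∀ y ∈ Q, x ≠ y → ∀ l, 2 ≤ l → l ≤ n * (h :: hs).length →
    ∃ L : List (Perm (Fin n)), L.IsChain (derangementGraph n).Adj ∧ L.Nodup ∧
      L.head? = some (x * h) ∧ L.getLast? = some (y * h) ∧ L.length = l ∧
      ∀ z ∈ L, ∃ q ∈ Q, ∃ k ∈ h :: hs, z = q * k := by
  classical
  have chain : ∀ (h : Perm (Fin n)) (L : List (Perm (Fin n))), L.Nodup → (∀ z ∈ L, z ∈ Q) →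
      (L.map (· * h)).IsChain (derangementGraph n).Adj := by
    intro h L h1 h2
    refine List.Pairwise.isChain (List.pairwise_map.2 ?_)
    refine List.Pairwise.imp_of_mem (fun {a b} ha hb hab => ?_) h1
    exact derangementGraph_adj_mul_right (by omega) (hQ (h2 a ha) (h2 b hb) hab) h
  have inside : ∀ x ∈ Q, ∀ y ∈ Q, x ≠ y → ∀ l, 2 ≤ l → l ≤ n →
      ∃ L : List (Perm (Fin n)), L.Nodup ∧ L.head? = some x ∧ L.getLast? = some y ∧
        L.length = l ∧ ∀ z ∈ L, z ∈ Q := by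
    intro x hx y hy hxy l hl hln
    obtain ⟨S, hS, hSc⟩ := Finset.exists_subset_card_eq (s := (Q.erase x).erase y) (n := l - 2)
      (by rw [Finset.card_erase_of_mem (Finset.mem_erase.2 ⟨hxy.symm, hy⟩),
            Finset.card_erase_of_mem hx]; omega)
    have hS' : ∀ z ∈ S, z ≠ y ∧ z ≠ x ∧ z ∈ Q := fun z hz => by simpa using hS hz
    refine ⟨x :: (S.toList ++ [y]), ?_, rfl, by simp [List.getLast?_cons], by simp [hSc]; omega, ?_⟩
    · simp [List.nodup_append, Finset.nodup_toList, hxy]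
      exact ⟨fun hx => (hS' x hx).2.1 rfl, fun hy => (hS' y hy).1 rfl⟩
    · intro z hz
      simp at hz
      rcases hz with rfl | hz | rfl
      exacts [hx, (hS' z hz).2.2, hy]
  induction hs with
  | nil =>
    intro h _ _ x hx y hy hxy l hl hln
    obtain ⟨L, h1, h2, h3, h4, h5⟩ := inside x hx y hy hxy l hl (by simpa using hln)
    refine ⟨L.map (· * h), chain h L h1 h5, h1.map (mul_left_injective h), by simp [h2],
      by simp [h3], by simp [h4], fun z hz => ?_⟩
    obtain ⟨q, hq, rfl⟩ := List.mem_map.1 hz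
    exact ⟨q, h5 q hq, h, by simp, rfl⟩
  | cons h' hs ih =>
    intro h hch hdis x hx y hy hxy l hl hln
    by_cases hle : l ≤ n
    · obtain ⟨L, h1, h2, h3, h4, h5⟩ := inside x hx y hy hxy l hl hle
      refine ⟨L.map (· * h), chain h L h1 h5, h1.map (mul_left_injective h), by simp [h2],
        by simp [h3], by simp [h4], fun z hz => ?_⟩
      obtain ⟨q, hq, rfl⟩ := List.mem_map.1 hz
      exact ⟨q, h5 q hq, h, by simp, rfl⟩
    obtain ⟨⟨a, b, hab, rfl⟩, hch'⟩ := List.isChain_cons_cons.1 hch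
    obtain ⟨hdis1, hdis2⟩ := List.pairwise_cons.1 hdis
    obtain ⟨m, hm, hmxy⟩ := Finset.exists_mem_notMem_of_card_lt_card (s := {x, y}) (t := Q)
      (lt_of_le_of_lt Finset.card_le_two (by omega))
    obtain ⟨d, hd, hdxym⟩ := Finset.exists_mem_notMem_of_card_lt_card (s := {x, y, m}) (t := Q)
      (lt_of_le_of_lt Finset.card_le_three (by omega))
    simp only [Finset.mem_insert, Finset.mem_singleton, not_or] at hmxy hdxym
    obtain ⟨v, hv, hvm, hvd, m', hm', v', hv', hmv', hadj1, hadj2⟩ :=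
      exists_disjoint_edges hn hQ hcard hab hm d
    -- the part of the first clique to be visited, and the number of vertices left to the others
    obtain ⟨B, l', hBQ, hl', hln', hsum, hBx, hBy, hBm, hBv⟩ :
        ∃ (B : Finset (Perm (Fin n))) (l' : ℕ), B ⊆ Q ∧ 2 ≤ l' ∧
          l' ≤ n * ((swap a b * h) :: hs).length ∧ B.card + l' = l ∧
          x ∈ B ∧ y ∈ B ∧ m ∈ B ∧ v ∈ B := by
      simp only [List.length_cons, mul_add, mul_one] at hln ⊢
      -- A detour has at least two vertices, so for `l = n + 1` the spare vertex `d` of the first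
      -- clique is skipped; this is why `v` had to avoid `d`.
      by_cases h1 : l = n + 1
      · refine ⟨Q.erase d, 2, Finset.erase_subset _ _, le_rfl, by omega, ?_, ?_⟩
        · rw [Finset.card_erase_of_mem hd]; omega
        · simp only [Finset.mem_erase]
          exact ⟨⟨Ne.symm hdxym.1, hx⟩, ⟨Ne.symm hdxym.2.1, hy⟩, ⟨Ne.symm hdxym.2.2, hm⟩, hvd, hv⟩
      · exact ⟨Q, l - n, subset_rfl, by omega, by omega, by omega, hx, hy, hm, hv⟩
    obtain ⟨A, C, u, w, huw, k1, k2, k3, k4, k5⟩ :=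
      B.exists_list_with_consecutive hBx hBy hBm hBv hxy hmxy.1 hmxy.2 hvm
    obtain ⟨u', hu', w', hw', huw', hau, haw⟩ : ∃ u' ∈ Q, ∃ w' ∈ Q, u' ≠ w' ∧
        (derangementGraph n).Adj u (u' * swap a b) ∧
        (derangementGraph n).Adj w (w' * swap a b) := by
      rcases huw with ⟨rfl, rfl⟩ | ⟨rfl, rfl⟩
      · exact ⟨m', hm', v', hv', hmv', hadj1, hadj2⟩
      · exact ⟨v', hv', m', hm', hmv'.symm, hadj2, hadj1⟩
    obtain ⟨P, p1, p2, p3, p4, p5, p6⟩ := ih _ hch' hdis2 u' hu' w' hw' huw' l' hl' hln'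
    have hk := chain h _ k1 fun z hz => hBQ (k5 z hz)
    have hnd : ((A ++ u :: w :: C).map (· * h)).Nodup := k1.map (mul_left_injective h)
    have hdisj : ∀ z ∈ (A ++ u :: w :: C).map (· * h), z ∉ P := by
      intro z hz hzP
      obtain ⟨q, hq, rfl⟩ := List.mem_map.1 hz
      obtain ⟨q', hq', k, hk, e⟩ := p6 _ hzP
      exact hdis1 k hk q (hBQ (k5 q hq)) q' hq' e
    have hsub : ∀ z ∈ (A ++ u :: w :: C).map (· * h), ∃ q ∈ Q, z = q * h := by
      intro z hz
      obtain ⟨q, hq, rfl⟩ := List.mem_map.1 hz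
      exact ⟨q, hBQ (k5 q hq), rfl⟩
    have hperm : (A.map (· * h) ++ (u * h) :: (P ++ (w * h) :: C.map (· * h))).Perm
        (P ++ (A ++ u :: w :: C).map (· * h)) := by
      simpa only [List.map_append, List.map_cons] using List.perm_splice _ _ _ _ _
    refine ⟨A.map (· * h) ++ (u * h) :: (P ++ (w * h) :: C.map (· * h)), ?_, ?_, ?_, ?_, ?_, ?_⟩
    · refine List.IsChain.splice (by simpa using hk) p1 p3 p4 ?_ ?_
      -- Right translation by `h` carries edges between `Q` and `Q * swap a b` to edges between the
      -- two current cliques.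
      · simpa [mul_assoc] using derangementGraph_adj_mul_right (by omega) hau h
      · simpa [mul_assoc] using (derangementGraph_adj_mul_right (by omega) haw h).symm
    · rw [hperm.nodup_iff]
      exact p2.append hnd fun z hz hz' => hdisj z hz' hz
    · have : ((A ++ u :: w :: C).map (· * h)).head? = some (x * h) := by
        rw [List.head?_map, k2]; rfl
      rw [← this]
      simp [List.head?_append]
    · have : ((A ++ u :: w :: C).map (· * h)).getLast? = some (y * h) := by
        rw [List.getLast?_map, k3]; rfl
      rw [← this]
      simp [List.getLast?_append, List.getLast?_cons]
    · rw [hperm.length_eq, List.length_append, List.length_map, k4, p5, add_comm, hsum]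
    · intro z hz
      rcases List.mem_append.1 (hperm.mem_iff.1 hz) with hz | hz
      · obtain ⟨q, hq, k, hk, e⟩ := p6 z hz
        exact ⟨q, hq, k, List.mem_cons_of_mem _ hk, e⟩
      · obtain ⟨q, hq, e⟩ := hsub z hz
        exact ⟨q, hq, h, List.mem_cons_self, e⟩

/-! ### Closing paths to cycles, and the theorem. -/

/-- A path of at least three vertices between the ends of an edge closes up to a cycle through
that edge. -/
theorem SimpleGraph.exists_isCycle_of_list {V : Type*} {G : SimpleGraph V} {x y : V}
    (hxy : G.Adj x y) {L : List V} (hL : L.IsChain G.Adj) (hnd : L.Nodup)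
    (hx : L.head? = some x) (hy : L.getLast? = some y) (hlen : 3 ≤ L.length) :
    ∃ (u : V) (p : G.Walk u u), p.IsCycle ∧ p.length = L.length ∧ s(x, y) ∈ p.edges := by
  have hne : L ≠ [] := by rintro rfl; simp at hx
  obtain ⟨p, hp⟩ : ∃ p : G.Walk x y, p.support = L := by
    have h1 : L.head hne = x := by rw [List.head?_eq_some_head hne] at hx; simpa using hx
    have h2 : L.getLast hne = y := by rw [List.getLast?_eq_some_getLast hne] at hy; simpa using hy
    exact ⟨(Walk.ofSupport L hne hL).copy h1 h2, by simp⟩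
  have hpath : p.IsPath := Walk.IsPath.mk' (hp ▸ hnd)
  have hplen : p.length + 1 = L.length := by rw [← hp, Walk.length_support]
  refine ⟨y, .cons hxy.symm p, (Walk.cons_isCycle_iff p hxy.symm).2 ⟨hpath, fun h => ?_⟩, ?_, ?_⟩
  -- A path using the edge between its own ends is just that edge.
  · have := hpath.length_eq_one_of_mem_edges (Sym2.eq_swap ▸ h)
    omega
  · simpa using hplen
  · simp [Sym2.eq_swap]

theorem theorem1p1 (n : ℕ) (hn : 4 ≤ n) : (derangementGraph n).IsEdgePancyclic := by
  classical
  intro e he l hl hle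
  induction e with
  | _ x y =>
  have hxy : (derangementGraph n).Adj x y := he
  obtain ⟨Q, hsub, hQ, hcard⟩ := exists_isClique_card_eq (n := n) (by omega) (n - 2) {x, y}
    (by
      rw [Finset.coe_pair, SimpleGraph.isClique_pair]
      exact fun _ => hxy)
    (by rw [Finset.card_pair hxy.ne]; omega)
  obtain ⟨k, rfl⟩ : ∃ k, n = k + 1 := ⟨n - 1, by omega⟩
  obtain ⟨H, h1, h2, h3, h4⟩ := exists_swap_hamiltonian_list k 1
  have hHlen : H.length = k.factorial := by
    rw [← List.toFinset_card_of_nodup h3,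
      Finset.eq_univ_iff_forall.2 fun σ => List.mem_toFinset.2 (h4 σ), Finset.card_univ,
      Fintype.card_perm, Fintype.card_fin]
  obtain ⟨T, rfl⟩ : ∃ T, H = 1 :: T := by
    cases H with
    | nil => simp at h1
    | cons g T => exact ⟨T, by simpa using h1⟩
  let f : Perm (Fin k) → Perm (Fin (k + 1)) := fun σ => Perm.decomposeFin.symm (0, σ)
  have hf1 : f 1 = 1 := (Perm.decomposeFin_symm_of_one 0).trans (swap_self 0)
  have hchain : (f 1 :: T.map f).IsChain DifferBySwap :=
    List.isChain_map_of_isChain f (fun _ _ h => h.decomposeFin_symm 0) h2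
  have hdisj : (f 1 :: T.map f).Pairwise
      fun k k' => ∀ q ∈ Q, ∀ q' ∈ Q, q * k ≠ q' * k' := by
    rw [← List.map_cons, List.pairwise_map]
    -- All `f σ` fix `0`, so evaluating at `0` gives `q 0 = q' 0`, which determines the row.
    refine List.Pairwise.imp (fun {σ τ} hne q hq q' hq' e => hne ?_) h3
    have hqq : q = q' := by
      refine eq_of_apply_eq_of_isClique (by omega) hQ hq hq' (i := 0) ?_
      simpa [f] using congrArg (fun g : Perm (Fin (k + 1)) => g 0) e
    subst hqq
    simpa [f] using mul_left_cancel e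
  obtain ⟨L, c1, c2, c3, c4, c5, -⟩ := exists_path_list hn hQ hcard (T.map f) (f 1) hchain hdisj
    x (hsub (by simp)) y (hsub (by simp)) hxy.ne l (by omega) (by
      rw [Fintype.card_perm, Fintype.card_fin, Nat.factorial_succ, ← hHlen] at hle
      simpa using hle)
  rw [hf1, mul_one] at c3 c4
  obtain ⟨u, p, p1, p2, p3⟩ := SimpleGraph.exists_isCycle_of_list hxy c1 c2 c3 c4 (by omega)
  exact ⟨u, p, p1, p2.trans c5, p3⟩
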